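/- Let $n \ge 0$ be an integer and let $f \in \mathbb{C}[\mathrm{GL}_n]$ be a regular function on $\mathrm{GL}_n(\mathbb{C})$, i.e. a function of the form $A \mapsto \det(A)^N p(A)$ with $N \in \mathbb{Z}$ and $p$ a polynomial in the entries of $A$. Let $\mathrm{s}\mathcal{A}(f) \subset \mathbb{R}^n$ be the matrix amoeba of $f$: the set of all $(\ln \lambda_1, \dots, \ln \lambda_n)$ where $\lambda_1, \dots, \lambda_n$ are the singular values, listed with multiplicity and in any order, of some $A \in \mathrm{GL}_n(\mathbb{C})$ with $f(A) = 0$. Let $\mu$ be the Haar probability measure on the unitary group $\mathrm{U}(n)$ and let the matrix Ronkin function $R_f : \mathbb{R}^n \to \mathbb{R} \cup \{-\infty\}$ be $$R_f(x) = \int_{\mathrm{U}(n) \times \mathrm{U}(n)} \ln \bigl| f\bigl(U \exp(\mathrm{diag}(x)) V^*\bigr) \bigr| \, d(\mu \times \mu)(U,V), \qquad \ln 0 = -\infty .$$ Then $R_f$ is real-valued and affine with integer gradient on every connected component $C$ of $\mathbb{R}^n \setminus \mathrm{s}\mathcal{A}(f)$: there are $m \in \mathbb{Z}^n$ and $c \in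 \mathbb{R}$ such that $R_f(x) = m_1 x_1 + \dots + m_n x_n + c$ for all $x \in C$. In particular, if $\mathrm{s}\mathcal{A}(f) \neq \mathbb{R}^n$, then $R_f$ is not identically $-\infty$. -/

import Mathlib

open scoped Matrix

namespace MatrixAmoeba

open MeasureTheory

/-- The unitary group `U(n)`. -/
abbrev U (n : ℕ) : Type := ↥(Matrix.unitaryGroup (Fin n) ℂ)

theorem isCompact_unitary (n : ℕ) :
    IsCompact ((Matrix.unitaryGroup (Fin n) ℂ : Submonoid (Matrix (Fin n) (Fin n) ℂ)) :
      Set (Matrix (Fin n) (Fin n) ℂ)) := by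
  have hK : IsCompact (Set.univ.pi fun _ : Fin n => Set.univ.pi fun _ : Fin n =>
      Metric.closedBall (0 : ℂ) 1) :=
    isCompact_univ_pi fun _ => isCompact_univ_pi fun _ => isCompact_closedBall 0 1
  refine hK.of_isClosed_subset (isClosed_unitary (R := Matrix (Fin n) (Fin n) ℂ)) ?_
  intro A hA i _ j _
  rw [mem_closedBall_zero_iff]
  exact entry_norm_bound_of_unitary hA i j

instance instCompactSpaceU (n : ℕ) : CompactSpace (U n) :=
  isCompact_iff_compactSpace.mp (isCompact_unitary n)

noncomputable instance instMeasurableSpaceU (n : ℕ) : MeasurableSpace (U n) := borel _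

instance instBorelSpaceU (n : ℕ) : BorelSpace (U n) := ⟨rfl⟩

/-- The Haar measure of the compact group `U(n)`, of total mass one. -/
noncomputable def haarU (n : ℕ) : Measure (U n) := Measure.haarMeasure ⊤

/-- Regular functions on `GL_n(ℂ)`: the functions `det ^ N * p` with `N : ℤ` and `p` a polynomial
in the matrix entries. -/
def IsRegular {n : ℕ} (f : GL (Fin n) ℂ → ℂ) : Prop :=
  ∃ (N : ℤ) (p : MvPolynomial (Fin n × Fin n) ℂ), ∀ A : GL (Fin n) ℂ,
    f A = (A : Matrix (Fin n) (Fin n) ℂ).det ^ N *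
      MvPolynomial.eval (fun ij => (A : Matrix (Fin n) (Fin n) ℂ) ij.1 ij.2) p

/-- The logarithms of the singular values of `A` (with multiplicity), in decreasing order: a
representative in `ℝⁿ` of `sLog A ∈ ℝⁿ / S_n`. -/
noncomputable def sLog {n : ℕ} (A : GL (Fin n) ℂ) : Fin n → ℝ := fun i =>
  Real.log ((Matrix.toEuclideanLin (A : Matrix (Fin n) (Fin n) ℂ)).singularValues i)

/-- The matrix amoeba of the hypersurface `f = 0`, that is the image of `{f = 0}` in `ℝⁿ / S_n`
under `sLog`, seen as a permutation-invariant subset of `ℝⁿ`. -/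
def sAmoeba {n : ℕ} (f : GL (Fin n) ℂ → ℂ) : Set (Fin n → ℝ) :=
  {x | ∃ A : GL (Fin n) ℂ, f A = 0 ∧ ∃ σ : Equiv.Perm (Fin n), x = sLog A ∘ σ}

/-- The invertible matrix `exp (diag x)`. -/
noncomputable def expDiag {n : ℕ} (x : Fin n → ℝ) : GL (Fin n) ℂ :=
  Matrix.GeneralLinearGroup.mkOfDetNeZero
    (Matrix.diagonal fun i => (Real.exp (x i) : ℂ))
    (by
      rw [Matrix.det_diagonal]
      exact Finset.prod_ne_zero_iff.mpr fun i _ =>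
        Complex.ofReal_ne_zero.mpr (Real.exp_ne_zero _))

theorem coe_expDiag {n : ℕ} (x : Fin n → ℝ) :
    (expDiag x : Matrix (Fin n) (Fin n) ℂ) =
      NormedSpace.exp (Matrix.diagonal fun i => (x i : ℂ)) := by
  rw [Matrix.exp_diagonal]
  ext i j
  simp [expDiag, Matrix.GeneralLinearGroup.mkOfDetNeZero, Matrix.diagonal_apply,
    Pi.coe_exp, ← Complex.exp_eq_exp_ℂ]

/-- The integral of an extended-real function, as the integral of the positive part minus the
integral of the negative part. It is the usual extended integral as soon as one of the two is
finite. -/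
noncomputable def extIntegral {α : Type*} [MeasurableSpace α] (μ : Measure α) (g : α → EReal) :
    EReal :=
  ((∫⁻ a, (g a).toENNReal ∂μ : ENNReal) : EReal) - ((∫⁻ a, (-g a).toENNReal ∂μ : ENNReal) : EReal)

/-- The matrix Ronkin function of `f`, with `ln 0 = -∞`. -/
noncomputable def ronkin {n : ℕ} (f : GL (Fin n) ℂ → ℂ) (x : Fin n → ℝ) : EReal :=
  extIntegral ((haarU n).prod (haarU n)) fun W : U n × U n =>
    ENNReal.log ‖f (Unitary.toUnits W.1 * expDiag x * Unitary.toUnits (star W.2))‖ₑ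

end MatrixAmoeba

/-!
The polynomial part `p` of a regular function `f = det ^ N * p` is studied on matrices
`U exp (diag ζ) V*` with complex `ζ`. An imaginary translation of `ζ i` by `θ` multiplies `U` from
the right by a diagonal unitary matrix. Two consequences follow. If `p` does not vanish on
`U exp (diag x) V*` for any `U`, `V`, then it does not vanish on any imaginary translate of `x`
either; and the mean over `U(n) × U(n)` of the partial logarithmic derivative of `p` at `x` is
unchanged when averaged over a period of `θ` as well. The inner average over `θ` is then the winding
number of a loop in `ℂ \ {0}`, an integer that depends continuously on `x`, `U` and `V`. As `U(n)` is
connected, this integer is constant on each component of the set of admissible `x`, so that the mean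
of `log ‖p‖`, whose partial derivatives are the real parts of the means above, is affine there with
integer gradient (`IsRotationFamily.exists_affine`). The factor `det ^ N` contributes
`N * ∑ i, x i`.

The set of non-admissible `x` is closed by compactness of `U(n)`, and lies in the amoeba since the
singular values of `U exp (diag x) V*` are the `exp (x i)` (`exists_perm_eq_sLog`). Hence every
component of the complement of the amoeba lies in a connected open set of admissible points. The
converse inclusion, that is the singular value decomposition, is not required.
-/

namespace MatrixAmoeba

open MeasureTheory Function
open scoped Real Topology

/-! ### Winding numbers of periodic holomorphic functions -/

/-- The integral over a period of the logarithmic derivative of a nowhere vanishing periodic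
function is an integer multiple of the period: dividing the function by the exponential of a
primitive of its logarithmic derivative leaves a constant. -/
theorem exists_int_integral_logDeriv {G G' : ℂ → ℂ} (hG : ∀ s, HasDerivAt G (G' s) s)
    (hG' : Continuous G') (a : ℂ) (hper : G (a + 2 * π * Complex.I) = G a)
    (hne : ∀ θ : ℝ, G (a + θ * Complex.I) ≠ 0) :
    ∃ k : ℤ, ∫ θ in (0 : ℝ)..2 * π, G' (a + θ * Complex.I) / G (a + θ * Complex.I) =
      2 * π * k := by
  set q : ℝ → ℂ := fun θ => G' (a + θ * Complex.I) / G (a + θ * Complex.I) with hq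
  have hGc : Continuous G := continuous_iff_continuousAt.2 fun s => (hG s).continuousAt
  have hqc : Continuous q := (by fun_prop : Continuous fun θ : ℝ => G' (a + θ * Complex.I)).div
    (by fun_prop) hne
  set J : ℝ → ℂ := fun t => ∫ θ in (0 : ℝ)..t, q θ with hJ
  have hJd (t : ℝ) : HasDerivAt J (q t) t := hqc.integral_hasStrictDerivAt 0 t |>.hasDerivAt
  have hφ (t : ℝ) : HasDerivAt (fun θ : ℝ => G (a + θ * Complex.I))
      (G' (a + t * Complex.I) * Complex.I) t := by
    have h1 : HasDerivAt (fun θ : ℝ => a + θ * Complex.I) Complex.I t := by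
      simpa using (((hasDerivAt_id t).ofReal_comp).mul_const Complex.I).const_add a
    exact (hG _).comp t h1
  have hψ (t : ℝ) : HasDerivAt
      (fun θ : ℝ => Complex.exp (-(Complex.I * J θ)) * G (a + θ * Complex.I)) 0 t := by
    have h1 := (((hJd t).const_mul Complex.I).neg.cexp).mul (hφ t)
    convert! h1 using 1
    have h2 : q t * G (a + t * Complex.I) = G' (a + t * Complex.I) := div_mul_cancel₀ _ (hne t)
    rw [← h2]
    ring
  have hconst := is_const_of_deriv_eq_zero (fun t => (hψ t).differentiableAt)
    (fun t => (hψ t).deriv) (2 * π) 0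
  have h0 : G (a + ((2 * π : ℝ) : ℂ) * Complex.I) = G a := by simpa using hper
  have hGa : G a ≠ 0 := by simpa using hne 0
  have hJ0 : J 0 = 0 := by simp [hJ]
  simp only [h0, hJ0, Complex.ofReal_zero, zero_mul, add_zero, mul_zero, neg_zero,
    Complex.exp_zero, one_mul] at hconst
  have hexp : Complex.exp (-(Complex.I * J (2 * π))) = 1 := mul_right_cancel₀ hGa (by simpa)
  obtain ⟨k, hk⟩ := Complex.exp_eq_one_iff.1 hexp
  refine ⟨-k, ?_⟩
  have hI : Complex.I ≠ 0 := Complex.I_ne_zero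
  change J (2 * π) = _
  apply mul_left_cancel₀ hI
  push_cast
  linear_combination -hk

theorem hasDerivAt_log_norm {g : ℝ → ℂ} {g' : ℂ} {t : ℝ} (hg : HasDerivAt g g' t)
    (h0 : g t ≠ 0) : HasDerivAt (fun s => Real.log ‖g s‖) (g' / g t).re t := by
  have h1 := (hg.norm_sq.log (by positivity)).div_const 2
  have h2 : (fun s => Real.log ‖g s‖) = fun s => Real.log (‖g s‖ ^ 2) / 2 := by
    ext s; rw [Real.log_pow]; push_cast; ring
  rw [h2]
  convert! h1 using 1
  have h3 : ‖g t‖ ^ 2 = Complex.normSq (g t) := (Complex.normSq_eq_norm_sq _).symm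
  have h4 : Complex.normSq (g t) ≠ 0 := by simpa using h0
  rw [h3, Complex.div_re, Complex.inner]
  simp only [Complex.mul_re, Complex.conj_re, Complex.conj_im]
  field_simp
  ring

/-- Fubini for a jointly continuous function on the product of an interval and a compact space. -/
theorem intervalIntegral_integral_swap_of_continuous {K : Type*} [TopologicalSpace K]
    [CompactSpace K] [T2Space K] [MeasurableSpace K] [OpensMeasurableSpace K] (μ : Measure K)
    [IsFiniteMeasure μ] {a b : ℝ} {f : ℝ → K → ℝ}
    (hf : ContinuousOn (uncurry f) (Set.uIcc a b ×ˢ Set.univ)) :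
    ∫ t in a..b, ∫ w, f t w ∂μ = ∫ w, (∫ t in a..b, f t w) ∂μ := by
  apply intervalIntegral_integral_swap
  have h1 : IntegrableOn (uncurry f) (Set.uIcc a b ×ˢ Set.univ) (volume.prod μ) :=
    hf.integrableOn_compact (isCompact_uIcc.prod isCompact_univ)
  have h2 : IntegrableOn (uncurry f) (Set.uIoc a b ×ˢ Set.univ) (volume.prod μ) :=
    h1.mono_set (Set.prod_mono Set.uIoc_subset_uIcc le_rfl)
  rwa [IntegrableOn, ← Measure.prod_restrict, Measure.restrict_univ] at h2

/-! ### Averages over families with torus symmetry -/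

/-- A family `F ζ w` of functions of `ζ ∈ ℂⁿ`, parametrized by a probability space `K`, that is
holomorphic and `2πi`-periodic in each coordinate `ζ i`, and for which an imaginary translation by
`θ i` in that coordinate amounts to the measure preserving change of parameter `rot i θ`. The
partial derivatives `F' i` are part of the data. -/
structure IsRotationFamily {n : ℕ} {K : Type*} [TopologicalSpace K] [MeasurableSpace K]
    (μ : Measure K) (F : (Fin n → ℂ) → K → ℂ) (F' : Fin n → (Fin n → ℂ) → K → ℂ)
    (rot : Fin n → ℝ → K → K) : Prop where
  continuous : Continuous (uncurry F)
  continuous_deriv : ∀ i, Continuous (uncurry (F' i))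
  hasDerivAt : ∀ i ζ w s, HasDerivAt (fun s => F (update ζ i s) w) (F' i (update ζ i s) w) s
  periodic : ∀ i ζ s w, F (update ζ i (s + 2 * π * Complex.I)) w = F (update ζ i s) w
  rotate : ∀ i ζ s (θ : ℝ) w,
    F (update ζ i (s + θ * Complex.I)) w = F (update ζ i s) (rot i θ w)
  integral_rot : ∀ i θ (g : K → ℝ), ∫ w, g (rot i θ w) ∂μ = ∫ w, g w ∂μ

/-- The inclusion `ℝⁿ ⊆ ℂⁿ`. -/
def toComplex {n : ℕ} (x : Fin n → ℝ) : Fin n → ℂ := fun i => (x i : ℂ)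

@[fun_prop]
theorem continuous_toComplex {n : ℕ} : Continuous (toComplex (n := n)) := by
  unfold toComplex; fun_prop

theorem toComplex_update {n : ℕ} (x : Fin n → ℝ) (i : Fin n) (t : ℝ) :
    toComplex (update x i t) = update (toComplex x) i (t : ℂ) := by
  ext j
  by_cases h : j = i
  · subst h; simp [toComplex]
  · simp [toComplex, h]

namespace IsRotationFamily

variable {n : ℕ} {K : Type*} [TopologicalSpace K] [MeasurableSpace K]
  {μ : Measure K} {F : (Fin n → ℂ) → K → ℂ} {F' : Fin n → (Fin n → ℂ) → K → ℂ}
  {rot : Fin n → ℝ → K → K}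

theorem deriv_rotate (h : IsRotationFamily μ F F' rot) (i : Fin n) (ζ : Fin n → ℂ) (s : ℂ) (θ : ℝ)
    (w : K) : F' i (update ζ i (s + θ * Complex.I)) w = F' i (update ζ i s) (rot i θ w) := by
  have h1 := (h.hasDerivAt i ζ w (s + θ * Complex.I)).comp_add_const s (θ * Complex.I)
  simp only [h.rotate] at h1
  exact h1.unique (h.hasDerivAt i ζ _ s)

theorem ne_zero_rotate (h : IsRotationFamily μ F F' rot) {x : Fin n → ℝ}
    (hx : ∀ w, F (toComplex x) w ≠ 0) (i : Fin n) (θ : ℝ) (w : K) :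
    F (update (toComplex x) i (x i + θ * Complex.I)) w ≠ 0 := by
  rw [h.rotate]
  have : update (toComplex x) i (x i : ℂ) = toComplex x := update_eq_self i (toComplex x)
  rw [this]
  exact hx _

/-- The winding number in the `i`-th coordinate depends continuously on the point and on the
parameter, hence is constant over a connected set of points and a connected parameter space. -/
theorem exists_int_winding [ConnectedSpace K] (h : IsRotationFamily μ F F' rot)
    {C : Set (Fin n → ℝ)} (hC : IsPreconnected C)
    (hne : ∀ x ∈ C, ∀ w, F (toComplex x) w ≠ 0) (i : Fin n) :
    ∃ k : ℤ, ∀ x ∈ C, ∀ w, ∫ θ in (0 : ℝ)..2 * π,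
      (F' i (update (toComplex x) i (x i + θ * Complex.I)) w /
        F (update (toComplex x) i (x i + θ * Complex.I)) w).re = 2 * π * k := by
  have : PreconnectedSpace C := isPreconnected_iff_preconnectedSpace.1 hC
  have hcont : Continuous (uncurry fun (z : C × K) (θ : ℝ) =>
      F' i (update (toComplex z.1) i (z.1.1 i + θ * Complex.I)) z.2 /
        F (update (toComplex z.1) i (z.1.1 i + θ * Complex.I)) z.2) := by
    have hu : Continuous fun q : (C × K) × ℝ =>
        (update (toComplex q.1.1) i (q.1.1.1 i + q.2 * Complex.I), q.1.2) := by
      have h1 : Continuous fun q : (C × K) × ℝ => q.1.1.1 i :=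
        (continuous_apply i).comp (continuous_subtype_val.comp (continuous_fst.comp continuous_fst))
      refine .prodMk (.update (by fun_prop) i (by fun_prop)) (by fun_prop)
    exact ((h.continuous_deriv i).comp hu).div (h.continuous.comp hu)
      fun q => h.ne_zero_rotate (hne _ q.1.1.2) i q.2 q.1.2
  have hint (z : C × K) : ∃ k : ℤ, ∫ θ in (0 : ℝ)..2 * π,
      (F' i (update (toComplex z.1) i (z.1.1 i + θ * Complex.I)) z.2 /
        F (update (toComplex z.1) i (z.1.1 i + θ * Complex.I)) z.2).re = 2 * π * k := by
    obtain ⟨k, hk⟩ := exists_int_integral_logDeriv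
      (h.hasDerivAt i (toComplex z.1) z.2) ((h.continuous_deriv i).comp
        (.prodMk (.update continuous_const i continuous_id) continuous_const))
      (z.1.1 i) (h.periodic i _ _ _) (h.ne_zero_rotate (hne _ z.1.2) i · z.2)
    refine ⟨k, ?_⟩
    have h1 := Complex.reCLM.intervalIntegral_comp_comm (a := 0) (b := 2 * π) (μ := volume)
      (f := fun θ : ℝ => F' i (update (toComplex z.1) i (z.1.1 i + θ * Complex.I)) z.2 /
        F (update (toComplex z.1) i (z.1.1 i + θ * Complex.I)) z.2)
      ((hcont.comp (.prodMk continuous_const continuous_id)).intervalIntegrable (a := 0) _)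
    exact h1.trans ((congrArg Complex.re hk).trans (by simp))
  choose k hk using hint
  have hkc : Continuous k := by
    rw [Int.isClosedEmbedding_coe_real.isInducing.continuous_iff]
    have h1 := intervalIntegral.continuous_parametric_intervalIntegral_of_continuous' (μ := volume)
      (f := fun (z : C × K) (θ : ℝ) =>
        (F' i (update (toComplex z.1) i (z.1.1 i + θ * Complex.I)) z.2 /
          F (update (toComplex z.1) i (z.1.1 i + θ * Complex.I)) z.2).re)
      (Complex.continuous_re.comp hcont) 0 (2 * π)
    have h2 : (fun z => (k z : ℝ)) = fun z => (2 * π)⁻¹ * (2 * π * k z) := by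
      ext z; field_simp
    change Continuous fun z => (k z : ℝ)
    rw [h2]
    simp only [← hk]
    exact continuous_const.mul h1
  rcases C.eq_empty_or_nonempty with rfl | ⟨x₀, hx₀⟩
  · exact ⟨0, by simp⟩
  obtain ⟨w₀⟩ : Nonempty K := inferInstance
  refine ⟨k (⟨x₀, hx₀⟩, w₀), fun x hx w => ?_⟩
  rw [← PreconnectedSpace.constant inferInstance hkc (x := (⟨x, hx⟩, w))]
  exact hk (⟨x, hx⟩, w)

variable [CompactSpace K] [T2Space K] [OpensMeasurableSpace K] [IsProbabilityMeasure μ]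

/-- The mean over the parameters of the real part of a logarithmic derivative does not change under
imaginary translations, so averaging it over a period computes it as the mean winding number. -/
theorem integral_logDeriv (h : IsRotationFamily μ F F' rot) {x : Fin n → ℝ}
    (hx : ∀ w, F (toComplex x) w ≠ 0) (i : Fin n) (k : ℤ)
    (hk : ∀ w, ∫ θ in (0 : ℝ)..2 * π,
      (F' i (update (toComplex x) i (x i + θ * Complex.I)) w /
        F (update (toComplex x) i (x i + θ * Complex.I)) w).re = 2 * π * k) :
    ∫ w, (F' i (toComplex x) w / F (toComplex x) w).re ∂μ = k := by
  have hu : Continuous fun q : ℝ × K =>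
      (update (toComplex x) i (x i + q.1 * Complex.I), q.2) :=
    .prodMk (.update (by fun_prop) i (by fun_prop)) (by fun_prop)
  have hswap := intervalIntegral_integral_swap_of_continuous μ (a := 0) (b := 2 * π)
    (f := fun θ w => (F' i (update (toComplex x) i (x i + θ * Complex.I)) w /
        F (update (toComplex x) i (x i + θ * Complex.I)) w).re)
    (Complex.continuous_re.comp (((h.continuous_deriv i).comp hu).div (h.continuous.comp hu)
      fun q => h.ne_zero_rotate hx i q.1 q.2)).continuousOn
  have hself : update (toComplex x) i (x i : ℂ) = toComplex x := update_eq_self i (toComplex x)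
  have hrot (θ : ℝ) : ∫ w, (F' i (update (toComplex x) i (x i + θ * Complex.I)) w /
      F (update (toComplex x) i (x i + θ * Complex.I)) w).re ∂μ =
      ∫ w, (F' i (toComplex x) w / F (toComplex x) w).re ∂μ := by
    simp only [h.rotate, h.deriv_rotate, hself]
    exact h.integral_rot i θ fun w => (F' i (toComplex x) w / F (toComplex x) w).re
  simp only [hrot, hk, intervalIntegral.integral_const, integral_const, sub_zero, probReal_univ,
    smul_eq_mul, one_mul] at hswap
  exact mul_left_cancel₀ (by positivity) hswap

/-- Along a coordinate segment avoiding the zeros, the mean of `log ‖F‖` is affine with slope the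
winding number. -/
theorem integral_log_norm_update (h : IsRotationFamily μ F F' rot) {C : Set (Fin n → ℝ)}
    (hne : ∀ x ∈ C, ∀ w, F (toComplex x) w ≠ 0) (i : Fin n) (k : ℤ)
    (hk : ∀ x ∈ C, ∀ w, ∫ θ in (0 : ℝ)..2 * π,
      (F' i (update (toComplex x) i (x i + θ * Complex.I)) w /
        F (update (toComplex x) i (x i + θ * Complex.I)) w).re = 2 * π * k)
    {z : Fin n → ℝ} {b : ℝ} (hz : ∀ s ∈ Set.uIcc (z i) b, update z i s ∈ C) :
    ∫ w, Real.log ‖F (toComplex (update z i b)) w‖ ∂μ =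
      ∫ w, Real.log ‖F (toComplex z) w‖ ∂μ + k * (b - z i) := by
  have hu : Continuous fun q : ℝ × K => (toComplex (update z i q.1), q.2) :=
    .prodMk (continuous_toComplex.comp (.update (by fun_prop) i (by fun_prop))) (by fun_prop)
  have hLc : ContinuousOn (uncurry fun (s : ℝ) w => (F' i (toComplex (update z i s)) w /
      F (toComplex (update z i s)) w).re) (Set.uIcc (z i) b ×ˢ Set.univ) := by
    refine Complex.continuous_re.comp_continuousOn
      (((h.continuous_deriv i).comp hu).continuousOn.div (h.continuous.comp hu).continuousOn
        fun q hq => hne _ (hz _ hq.1) _)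
  have hFTC (w : K) : ∫ s in (z i)..b, (F' i (toComplex (update z i s)) w /
      F (toComplex (update z i s)) w).re =
      Real.log ‖F (toComplex (update z i b)) w‖ - Real.log ‖F (toComplex z) w‖ := by
    have := intervalIntegral.integral_eq_sub_of_hasDerivAt (a := z i) (b := b)
      (f := fun s => Real.log ‖F (toComplex (update z i s)) w‖)
      (f' := fun s => (F' i (toComplex (update z i s)) w / F (toComplex (update z i s)) w).re)
      (fun s hs => ?_) ?_
    · rwa [update_eq_self] at this
    · refine hasDerivAt_log_norm ?_ (hne _ (hz s hs) w)
      simp only [toComplex_update]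
      exact (h.hasDerivAt i (toComplex z) w s).comp_ofReal
    · exact (hLc.comp (f := fun s => (s, w)) (by fun_prop)
        fun s hs => ⟨hs, trivial⟩).intervalIntegrable
  have hint (x : Fin n → ℝ) (hx : x ∈ C) :
      Integrable (fun w => Real.log ‖F (toComplex x) w‖) μ := by
    have hc : Continuous fun w => Real.log ‖F (toComplex x) w‖ :=
      (h.continuous.comp (.prodMk continuous_const continuous_id)).norm.log
        fun w => norm_ne_zero_iff.2 (hne x hx w)
    simpa using hc.continuousOn.integrableOn_compact (μ := μ) isCompact_univ
  have hswap := intervalIntegral_integral_swap_of_continuous μ hLc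
  have hmean : ∀ s ∈ Set.uIcc (z i) b, ∫ w, (F' i (toComplex (update z i s)) w /
      F (toComplex (update z i s)) w).re ∂μ = k := fun s hs =>
    h.integral_logDeriv (hne _ (hz s hs)) i k (hk _ (hz s hs))
  have hzC : z ∈ C := by simpa using hz (z i) Set.left_mem_uIcc
  rw [intervalIntegral.integral_congr hmean] at hswap
  simp only [hFTC, intervalIntegral.integral_const, smul_eq_mul] at hswap
  rw [integral_sub (hint _ (hz b Set.right_mem_uIcc)) (hint z hzC)] at hswap
  linarith

/-- The mean of `log ‖F‖` is affine with integer gradient over a connected open set of points at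
which no member of the family vanishes. -/
theorem exists_affine [ConnectedSpace K] (h : IsRotationFamily μ F F' rot) {C : Set (Fin n → ℝ)}
    (hCo : IsOpen C) (hC : IsPreconnected C) (hne : ∀ x ∈ C, ∀ w, F (toComplex x) w ≠ 0) :
    ∃ (m : Fin n → ℤ) (c : ℝ), ∀ x ∈ C,
      ∫ w, Real.log ‖F (toComplex x) w‖ ∂μ = ∑ i, (m i : ℝ) * x i + c := by
  choose m hm using h.exists_int_winding hC hne
  set R : (Fin n → ℝ) → ℝ := fun x => ∫ w, Real.log ‖F (toComplex x) w‖ ∂μ with hR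
  -- In a cube contained in `C`, change the coordinates one at a time.
  have hcube (x : Fin n → ℝ) (r : ℝ) (hr : 0 < r) (hball : Metric.ball x r ⊆ C) (y : Fin n → ℝ)
      (hy : y ∈ Metric.ball x r) (S : Finset (Fin n)) :
      R (S.piecewise y x) = R x + ∑ i ∈ S, (m i : ℝ) * (y i - x i) := by
    induction S using Finset.induction_on with
    | empty => simp
    | insert j S hj ih =>
      rw [Finset.piecewise_insert, Finset.sum_insert hj]
      have := h.integral_log_norm_update hne j (m j) (hm j) (z := S.piecewise y x) (b := y j) ?_
      · simp only [hR] at ih ⊢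
        rw [this, ih]
        simp [hj]
        ring
      · intro s hs
        apply hball
        rw [Metric.mem_ball, dist_pi_lt_iff hr] at hy ⊢
        intro l
        by_cases hl : l = j
        · subst hl
          have hx0 : S.piecewise y x l = x l := by simp [hj]
          rw [hx0, Set.uIcc_comm] at hs
          rw [update_self]
          refine lt_of_le_of_lt ?_ (hy l)
          rw [Real.dist_eq, Real.dist_eq]
          exact Set.abs_sub_right_of_mem_uIcc hs |>.trans_eq' (abs_sub_comm _ _)
            |>.trans_eq (abs_sub_comm _ _)
        · rw [update_of_ne hl]
          by_cases hlS : l ∈ S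
          · simpa [hlS] using hy l
          · simpa [hlS] using hr
  have hloc : IsLocallyConstant fun x : C => R x - ∑ i, (m i : ℝ) * x.1 i := by
    rw [IsLocallyConstant.iff_eventually_eq]
    intro x
    obtain ⟨r, hr, hball⟩ := Metric.isOpen_iff.1 hCo x x.2
    filter_upwards [continuous_subtype_val.continuousAt.preimage_mem_nhds
      (Metric.ball_mem_nhds x.1 hr)] with y hy
    have := hcube x r hr hball y hy Finset.univ
    rw [Finset.piecewise_univ] at this
    rw [this]
    simp only [mul_sub, Finset.sum_sub_distrib]
    ring
  rcases C.eq_empty_or_nonempty with rfl | ⟨x₀, hx₀⟩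
  · exact ⟨0, 0, by simp⟩
  have : PreconnectedSpace C := isPreconnected_iff_preconnectedSpace.1 hC
  refine ⟨m, R x₀ - ∑ i, (m i : ℝ) * x₀ i, fun x hx => ?_⟩
  have := hloc.apply_eq_of_preconnectedSpace ⟨x, hx⟩ ⟨x₀, hx₀⟩
  simp only at this
  rw [← this]
  ring

end IsRotationFamily

/-! ### The unitary group -/

instance instSecondCountableTopologyU (n : ℕ) : SecondCountableTopology (U n) :=
  have : SecondCountableTopology (Matrix (Fin n) (Fin n) ℂ) :=
    inferInstanceAs (SecondCountableTopology (Fin n → Fin n → ℂ))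
  TopologicalSpace.Subtype.secondCountableTopology _

instance instIsHaarMeasureHaarU (n : ℕ) : (haarU n).IsHaarMeasure := by
  unfold haarU; infer_instance

instance instIsProbabilityMeasureHaarU (n : ℕ) : IsProbabilityMeasure (haarU n) :=
  ⟨Measure.haarMeasure_self (K₀ := (⊤ : TopologicalSpace.PositiveCompacts (U n)))⟩

/-- Compact groups are unimodular: a right translate of the normalized Haar measure is again a
Haar probability measure. -/
instance instIsMulRightInvariantHaarU (n : ℕ) : (haarU n).IsMulRightInvariant where
  map_mul_right_eq_self g := by
    have : IsProbabilityMeasure ((haarU n).map (· * g)) :=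
      Measure.isProbabilityMeasure_map (by fun_prop)
    exact Measure.isHaarMeasure_eq_of_isProbabilityMeasure _ _

open scoped Matrix.Norms.L2Operator in
theorem joined_one_of_neg_one_notMem_spectrum {n : ℕ} (u : U n)
    (h : (-1 : ℂ) ∉ spectrum ℂ (u : Matrix (Fin n) (Fin n) ℂ)) : Joined 1 u :=
  Unitary.joined (1 : U n) u (by simpa using (Unitary.norm_sub_one_lt_two_iff u.2).2 h)

/-- The diagonal unitary matrix with diagonal entries `exp (i θⱼ)`. -/
noncomputable def diagU {n : ℕ} (θ : Fin n → ℝ) : U n :=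
  ⟨Matrix.diagonal fun j => Complex.exp (θ j * Complex.I), by
    rw [Matrix.mem_unitaryGroup_iff, Matrix.star_eq_conjTranspose, Matrix.diagonal_conjTranspose,
      Matrix.diagonal_mul_diagonal, ← Matrix.diagonal_one]
    congr 1
    ext j
    simp [← Complex.exp_conj, ← Complex.exp_add]⟩

theorem continuous_diagU {n : ℕ} : Continuous (diagU (n := n)) :=
  Continuous.subtype_mk (Continuous.matrix_diagonal (by fun_prop)) _

theorem joined_one_diagU {n : ℕ} (θ : Fin n → ℝ) : Joined 1 (diagU θ) := by
  have h0 : diagU (0 : Fin n → ℝ) = 1 := by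
    ext1
    simp [diagU]
  have := (PathConnectedSpace.joined (0 : Fin n → ℝ) θ).map continuous_diagU
  rwa [h0] at this

/-- The spectrum of `u` is finite, so some multiple of `u` by a unit scalar does not have the
eigenvalue `-1`, hence is joined to `1`; and scalars are joined to `1` as well. -/
instance instPathConnectedSpaceU (n : ℕ) : PathConnectedSpace (U n) := by
  suffices h : ∀ u : U n, Joined 1 u from
    ⟨⟨1⟩, fun u v => (h u).symm.trans (h v)⟩
  intro u
  obtain ⟨t, ht⟩ : ∃ t : ℝ, -Complex.exp (-(t * Complex.I)) ∉
      spectrum ℂ (u : Matrix (Fin n) (Fin n) ℂ) := by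
    by_contra! hcon
    have hinj : Set.InjOn (fun t : ℝ => -Complex.exp (-(t * Complex.I))) (Set.Ioo 0 1) := by
      intro s hs t ht hst
      simp only [neg_inj] at hst
      have h1 := congrArg Complex.log hst
      have hp := Real.pi_gt_three
      rw [Complex.log_exp, Complex.log_exp] at h1
      · simpa using h1
      all_goals simp
      all_goals first | linarith [hs.1, hs.2] | linarith [ht.1, ht.2]
    exact (Set.Ioo_infinite (zero_lt_one' ℝ)).image hinj
      ((Matrix.finite_spectrum (u : Matrix (Fin n) (Fin n) ℂ)).subset
        (Set.image_subset_iff.2 fun t _ => hcon t))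
  have hspec : (-1 : ℂ) ∉ spectrum ℂ ((diagU (fun _ => t) * u : U n) :
      Matrix (Fin n) (Fin n) ℂ) := by
    intro hmem
    apply ht
    have hsm : ((diagU (fun _ => t) * u : U n) : Matrix (Fin n) (Fin n) ℂ) =
        Complex.exp (t * Complex.I) • (u : Matrix (Fin n) (Fin n) ℂ) := by
      simp [diagU, Matrix.smul_eq_diagonal_mul]
    rw [hsm, ← Units.val_mk0 (Complex.exp_ne_zero (t * Complex.I)), ← Units.smul_def,
      spectrum.unit_smul_eq_smul] at hmem
    obtain ⟨z, hz, hz1⟩ := hmem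
    have : z = -Complex.exp (-(t * Complex.I)) := by
      have h1 : Complex.exp (t * Complex.I) * z = -1 := hz1
      have h2 : Complex.exp (-(t * Complex.I)) * Complex.exp (t * Complex.I) = 1 := by
        simp [← Complex.exp_add]
      linear_combination Complex.exp (-(t * Complex.I)) * h1 - z * h2
    rwa [← this]
  have h1 := (joined_one_diagU fun _ : Fin n => t).symm
  have h2 := joined_one_of_neg_one_notMem_spectrum _ hspec
  have h3 := ((h1.trans h2).map (f := fun v => (diagU fun _ : Fin n => t)⁻¹ * v) (by fun_prop))
  simpa using h3

/-! ### Singular values -/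

/-- Two families with the same multiset of values become equal after sorting, hence differ by a
permutation. -/
theorem exists_perm_of_multiset_map_eq {n : ℕ} {f g : Fin n → ℝ}
    (h : Multiset.map f Finset.univ.val = Multiset.map g Finset.univ.val) :
    ∃ σ : Equiv.Perm (Fin n), f = g ∘ σ := by
  have hp : (List.ofFn f).Perm (List.ofFn g) := by
    rw [← Multiset.coe_eq_coe]
    simpa [Fin.univ_val_map] using h
  have hs (f : Fin n → ℝ) : (List.ofFn (f ∘ Tuple.sort f)).Perm (List.ofFn f) :=
    Equiv.Perm.ofFn_comp_perm _ _
  have heq := ((hs f).trans (hp.trans (hs g).symm)).eq_of_pairwise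
    (fun a b _ _ hab hba => le_antisymm hab hba) (Tuple.monotone_sort f).sortedLE_ofFn.pairwise
    (Tuple.monotone_sort g).sortedLE_ofFn.pairwise
  refine ⟨(Tuple.sort f)⁻¹.trans (Tuple.sort g), ?_⟩
  have h2 := List.ofFn_injective heq
  ext i
  have := congrFun h2 ((Tuple.sort f)⁻¹ i)
  simpa using this

/-- The singular values of `A = U exp (diag x) V*` are the `exp (x i)`: the matrix `Aᴴ * A` is
conjugate to `exp (diag x) ^ 2`, so the two have the same characteristic polynomial. -/
theorem exists_perm_eq_sLog {n : ℕ} (W : U n × U n) (x : Fin n → ℝ) :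
    ∃ σ : Equiv.Perm (Fin n),
      x = sLog (Unitary.toUnits W.1 * expDiag x * Unitary.toUnits (star W.2)) ∘ σ := by
  set A := Unitary.toUnits W.1 * expDiag x * Unitary.toUnits (star W.2) with hA
  set M : Matrix (Fin n) (Fin n) ℂ := (A : Matrix (Fin n) (Fin n) ℂ) with hM
  set T := Matrix.toEuclideanLin M
  have hn : Module.finrank ℂ (EuclideanSpace ℂ (Fin n)) = n := by simp
  have hMM : Mᴴ * M = (W.2 : Matrix (Fin n) (Fin n) ℂ) *
      (Matrix.diagonal (fun i => ((Real.exp (x i) ^ 2 : ℝ) : ℂ)) *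
        star (W.2 : Matrix (Fin n) (Fin n) ℂ)) := by
    have h1 : M = W.1 * (Matrix.diagonal fun i => (Real.exp (x i) : ℂ)) *
      star (W.2 : Matrix (Fin n) (Fin n) ℂ) := rfl
    have h2 : (Matrix.diagonal fun i => (Real.exp (x i) : ℂ))ᴴ *
        (Matrix.diagonal fun i => (Real.exp (x i) : ℂ)) =
        Matrix.diagonal (fun i => ((Real.exp (x i) ^ 2 : ℝ) : ℂ)) := by
      rw [Matrix.diagonal_conjTranspose, Matrix.diagonal_mul_diagonal]
      congr 1
      ext i
      simp [sq, ← Complex.exp_conj]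
    have h3 : (W.1 : Matrix (Fin n) (Fin n) ℂ)ᴴ * W.1 = 1 := Unitary.coe_star_mul_self W.1
    rw [h1, ← h2]
    simp only [Matrix.conjTranspose_mul, Matrix.star_eq_conjTranspose,
      Matrix.conjTranspose_conjTranspose, mul_assoc]
    rw [← mul_assoc _ (W.1 : Matrix (Fin n) (Fin n) ℂ), h3, one_mul]
  have hchar : (LinearMap.adjoint T ∘ₗ T).charpoly =
      ∏ i, (Polynomial.X - Polynomial.C ((Real.exp (x i) ^ 2 : ℝ) : ℂ)) := by
    have h1 : LinearMap.adjoint T ∘ₗ T = Matrix.toEuclideanLin (Mᴴ * M) := by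
      rw [← Matrix.toEuclideanLin_conjTranspose_eq_adjoint]
      ext v
      simp [T]
    change _ = Matrix.toLpLin 2 2 (Mᴴ * M) at h1
    rw [h1, Matrix.toLpLin_eq_toLin, Matrix.charpoly_toLin, hMM, Matrix.charpoly_mul_comm,
      mul_assoc, Unitary.coe_star_mul_self, mul_one, Matrix.charpoly_diagonal]
  have hroots := T.isSymmetric_adjoint_comp_self.roots_charpoly_eq_eigenvalues hn
  have hroots' := Polynomial.roots_multiset_prod_X_sub_C
    (Multiset.map (fun i => ((Real.exp (x i) ^ 2 : ℝ) : ℂ)) Finset.univ.val)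
  rw [Multiset.map_map] at hroots'
  rw [hchar] at hroots
  replace hroots := hroots'.symm.trans hroots
  have hmap := congrArg (Multiset.map fun z : ℂ => Real.log (√z.re)) hroots
  rw [Multiset.map_map, Multiset.map_map] at hmap
  apply exists_perm_of_multiset_map_eq
  convert! hmap using 2
  · rw [Function.comp_apply, Complex.ofReal_re, Real.sqrt_sq (Real.exp_pos _).le, Real.log_exp]
  · simp only [sLog, Function.comp_apply]
    rw [LinearMap.singularValues_fin _ hn]
    simp [T, hM]

/-! ### Polynomials evaluated on the Cartan decomposition -/

/-- The value of the polynomial `p` at the matrix `A * exp (diag ζ) * B`, as a function of the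
triple `(ζ, A, B)`. -/
noncomputable def cartanEval {n : ℕ} (p : MvPolynomial (Fin n × Fin n) ℂ)
    (q : (Fin n → ℂ) × (Fin n → Fin n → ℂ) × (Fin n → Fin n → ℂ)) : ℂ :=
  MvPolynomial.eval (fun ij => ∑ k, q.2.1 ij.1 k * Complex.exp (q.1 k) * q.2.2 k ij.2) p

theorem contDiff_cartanEval {n : ℕ} (p : MvPolynomial (Fin n × Fin n) ℂ) :
    ContDiff ℂ 1 (cartanEval p) := by
  unfold cartanEval
  induction p using MvPolynomial.induction_on with
  | C a => simpa using contDiff_const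
  | add p q hp hq => simpa using hp.add hq
  | mul_X p ij hp =>
    simp only [map_mul, MvPolynomial.eval_X]
    refine hp.mul ?_
    fun_prop

/-- The parameters `(A, B) = (U, V*)` of `cartanEval` attached to a pair of unitary matrices. -/
def unitaryPair {n : ℕ} (W : U n × U n) : (Fin n → Fin n → ℂ) × (Fin n → Fin n → ℂ) :=
  (fun i j => (W.1 : Matrix (Fin n) (Fin n) ℂ) i j,
    fun i j => (star (W.2 : Matrix (Fin n) (Fin n) ℂ)) i j)

theorem continuous_unitaryPair {n : ℕ} : Continuous (unitaryPair (n := n)) := by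
  have h1 : Continuous fun W : U n × U n => (W.1 : Matrix (Fin n) (Fin n) ℂ) := by fun_prop
  have h2 : Continuous fun W : U n × U n => star (W.2 : Matrix (Fin n) (Fin n) ℂ) := by fun_prop
  exact h1.prodMk h2

theorem continuous_cartanEval_unitaryPair {n : ℕ} (p : MvPolynomial (Fin n × Fin n) ℂ) :
    Continuous fun q : (Fin n → ℂ) × (U n × U n) => cartanEval p (q.1, unitaryPair q.2) :=
  (contDiff_cartanEval p).continuous.comp
    (continuous_fst.prodMk (continuous_unitaryPair.comp continuous_snd))

/-- A polynomial in the entries of `U exp (diag ζ) V*` is a rotation family over `U(n) × U(n)`: an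
imaginary translation of `ζ i` multiplies `U` from the right by a diagonal unitary matrix, which
preserves the Haar measure. -/
theorem isRotationFamily_cartanEval {n : ℕ} (p : MvPolynomial (Fin n × Fin n) ℂ) :
    IsRotationFamily ((haarU n).prod (haarU n)) (fun ζ W => cartanEval p (ζ, unitaryPair W))
      (fun i ζ W => fderiv ℂ (cartanEval p) (ζ, unitaryPair W) (Pi.single i 1, 0))
      (fun i θ W => W * (diagU (Pi.single i θ), 1)) where
  continuous := continuous_cartanEval_unitaryPair p
  continuous_deriv i := (((contDiff_cartanEval p).continuous_fderiv one_ne_zero).comp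
    (continuous_fst.prodMk (continuous_unitaryPair.comp continuous_snd))).clm_apply
      continuous_const
  hasDerivAt i ζ W s := by
    have h1 : HasDerivAt (fun s => (update ζ i s, unitaryPair W)) (Pi.single i 1, 0) s :=
      (hasDerivAt_update ζ i s).prodMk (hasDerivAt_const s _)
    exact (((contDiff_cartanEval p).differentiable one_ne_zero _).hasFDerivAt).comp_hasDerivAt s h1
  periodic i ζ s W := by
    unfold cartanEval
    congr 2
    ext ij
    refine Finset.sum_congr rfl fun k _ => ?_
    by_cases hk : k = i
    · subst hk
      simp [Complex.exp_add]
    · simp [hk]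
  rotate i ζ s θ W := by
    unfold cartanEval
    congr 2
    ext ij
    refine Finset.sum_congr rfl fun k _ => ?_
    by_cases hk : k = i
    · subst hk
      simp only [unitaryPair, diagU, update_self, Prod.fst_mul, Prod.snd_mul, mul_one,
        Submonoid.coe_mul, Matrix.mul_diagonal, Pi.single_eq_same, Complex.exp_add]
      ring
    · simp [hk, unitaryPair, diagU]
  integral_rot i θ g := integral_mul_right_eq_self g _

theorem isClosed_setOf_exists_cartanEval_eq_zero {n : ℕ} (p : MvPolynomial (Fin n × Fin n) ℂ) :
    IsClosed {x : Fin n → ℝ | ∃ W, cartanEval p (toComplex x, unitaryPair W) = 0} := by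
  have hx : Continuous fun q : (Fin n → ℝ) × (U n × U n) => (toComplex q.1, q.2) := by fun_prop
  have hc := (continuous_cartanEval_unitaryPair p).comp hx
  have := isClosedMap_fst_of_compactSpace _ (isClosed_eq hc (continuous_const (y := (0 : ℂ))))
  convert! this
  ext x
  simp

theorem integrable_log_norm_cartanEval {n : ℕ} (p : MvPolynomial (Fin n × Fin n) ℂ)
    {x : Fin n → ℝ} (hx : ∀ W, cartanEval p (toComplex x, unitaryPair W) ≠ 0) :
    Integrable (fun W => Real.log ‖cartanEval p (toComplex x, unitaryPair W)‖)
      ((haarU n).prod (haarU n)) := by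
  have hc : Continuous fun W => Real.log ‖cartanEval p (toComplex x, unitaryPair W)‖ :=
    ((continuous_cartanEval_unitaryPair p).comp (.prodMk continuous_const continuous_id)).norm.log
      fun W => norm_ne_zero_iff.2 (hx W)
  exact integrableOn_univ.1 (hc.continuousOn.integrableOn_compact isCompact_univ)

/-- The factor `d` is the value of `det ^ N`, whose modulus does not depend on the unitary
matrices. -/
theorem apply_eq_det_zpow_mul_cartanEval {n : ℕ} {f : GL (Fin n) ℂ → ℂ} {N : ℤ}
    {p : MvPolynomial (Fin n × Fin n) ℂ}
    (hf : ∀ A : GL (Fin n) ℂ, f A = (A : Matrix (Fin n) (Fin n) ℂ).det ^ N *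
      MvPolynomial.eval (fun ij => (A : Matrix (Fin n) (Fin n) ℂ) ij.1 ij.2) p)
    (x : Fin n → ℝ) (W : U n × U n) :
    ∃ d : ℂ, ‖d‖ = Real.exp (N * ∑ i, x i) ∧
      f (Unitary.toUnits W.1 * expDiag x * Unitary.toUnits (star W.2)) =
        d * cartanEval p (toComplex x, unitaryPair W) := by
  have hA : ((Unitary.toUnits W.1 * expDiag x * Unitary.toUnits (star W.2) : GL (Fin n) ℂ) :
      Matrix (Fin n) (Fin n) ℂ) = W.1 * (Matrix.diagonal fun i => (Real.exp (x i) : ℂ)) *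
        star (W.2 : Matrix (Fin n) (Fin n) ℂ) := rfl
  have hU (V : U n) : ‖(V : Matrix (Fin n) (Fin n) ℂ).det‖ = 1 :=
    CStarRing.norm_of_mem_unitary (Matrix.det_of_mem_unitary V.2)
  refine ⟨_, ?_, (hf _).trans (congrArg _ ?_)⟩
  · rw [hA, Matrix.det_mul, Matrix.det_mul, Matrix.det_diagonal, norm_zpow, norm_mul, norm_mul,
      hU W.1, ← Unitary.coe_star, hU (star W.2), norm_prod, one_mul, mul_one, mul_comm,
      Real.exp_mul, Real.rpow_intCast, Real.exp_sum]
    simp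
  · rw [hA]
    unfold cartanEval
    congr 2
    ext ij
    rw [Matrix.mul_apply]
    simp [unitaryPair, toComplex, Matrix.mul_diagonal]

/-! ### The Ronkin function off the amoeba -/

theorem extIntegral_coe {α : Type*} [MeasurableSpace α] {μ : Measure α} {g : α → ℝ}
    (hg : Integrable g μ) :
    extIntegral μ (fun a => (g a : EReal)) = ((∫ a, g a ∂μ : ℝ) : EReal) := by
  have h1 : (∫⁻ a, ENNReal.ofReal (g a) ∂μ) ≠ ⊤ :=
    (hg.lintegral_lt_top).ne
  have h2 : (∫⁻ a, ENNReal.ofReal (-g a) ∂μ) ≠ ⊤ :=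
    (hg.neg.lintegral_lt_top).ne
  rw [integral_eq_lintegral_pos_part_sub_lintegral_neg_part hg, EReal.coe_sub,
    EReal.coe_ennreal_toReal h1, EReal.coe_ennreal_toReal h2]
  rfl

theorem log_enorm {z : ℂ} (hz : z ≠ 0) : ENNReal.log ‖z‖ₑ = (Real.log ‖z‖ : EReal) := by
  rw [← ofReal_norm, ENNReal.log_ofReal_of_pos (norm_pos_iff.2 hz)]

end MatrixAmoeba

theorem mainTheorem6 {n : ℕ} (f : GL (Fin n) ℂ → ℂ) (hf : MatrixAmoeba.IsRegular f) :
    (∀ x₀ ∈ (MatrixAmoeba.sAmoeba f)ᶜ, ∃ (m : Fin n → ℤ) (c : ℝ),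
      ∀ x ∈ connectedComponentIn (MatrixAmoeba.sAmoeba f)ᶜ x₀,
        MatrixAmoeba.ronkin f x = (((∑ i, (m i : ℝ) * x i) + c : ℝ) : EReal)) ∧
    ((MatrixAmoeba.sAmoeba f)ᶜ.Nonempty → ∃ x, MatrixAmoeba.ronkin f x ≠ ⊥) := by
  open MatrixAmoeba MeasureTheory in
  have hmain : ∀ x₀ ∈ (sAmoeba f)ᶜ, ∃ (m : Fin n → ℤ) (c : ℝ),
      ∀ x ∈ connectedComponentIn (sAmoeba f)ᶜ x₀,
        ronkin f x = (((∑ i, (m i : ℝ) * x i) + c : ℝ) : EReal) := by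
    intro x₀ hx₀
    obtain ⟨N, p, hp⟩ := hf
    have hfam := isRotationFamily_cartanEval p
    -- The points over which the polynomial part vanishes somewhere: a closed part of the amoeba.
    set Z : Set (Fin n → ℝ) := {x | ∃ W, cartanEval p (toComplex x, unitaryPair W) = 0}
    have hZc : IsClosed Z := isClosed_setOf_exists_cartanEval_eq_zero p
    have hZA : Z ⊆ sAmoeba f := by
      rintro x ⟨W, hW⟩
      obtain ⟨d, -, hd⟩ := apply_eq_det_zpow_mul_cartanEval hp x W
      exact ⟨_, by rw [hd, hW, mul_zero], exists_perm_eq_sLog W x⟩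
    have hsub := connectedComponentIn_mono x₀ (Set.compl_subset_compl.2 hZA)
    have hne : ∀ x ∈ connectedComponentIn Zᶜ x₀, ∀ W,
        cartanEval p (toComplex x, unitaryPair W) ≠ 0 := fun x hx W hW =>
      connectedComponentIn_subset _ _ hx ⟨W, hW⟩
    obtain ⟨m, c, hmc⟩ := hfam.exists_affine hZc.isOpen_compl.connectedComponentIn
      isPreconnected_connectedComponentIn hne
    refine ⟨fun i => m i + N, c, fun x hx => ?_⟩
    replace hx := hsub hx
    have hint := integrable_log_norm_cartanEval p (hne x hx)
    have hlog (W : U n × U n) :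
        ENNReal.log ‖f (Unitary.toUnits W.1 * expDiag x * Unitary.toUnits (star W.2))‖ₑ =
          ((N * ∑ i, x i + Real.log ‖cartanEval p (toComplex x, unitaryPair W)‖ : ℝ) : EReal) := by
      obtain ⟨d, hd, hfd⟩ := apply_eq_det_zpow_mul_cartanEval hp x W
      have hd0 : d ≠ 0 := norm_ne_zero_iff.1 (hd ▸ Real.exp_ne_zero _)
      rw [hfd, log_enorm (mul_ne_zero hd0 (hne x hx W)), norm_mul,
        Real.log_mul (norm_ne_zero_iff.2 hd0) (norm_ne_zero_iff.2 (hne x hx W)), hd, Real.log_exp]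
    unfold ronkin
    simp only [hlog]
    have hadd := (integrable_const (μ := (haarU n).prod (haarU n)) (N * ∑ i, x i)).fun_add hint
    rw [extIntegral_coe hadd, integral_add (integrable_const _) hint, hmc x hx]
    congr 1
    simp only [integral_const, probReal_univ, one_smul, Int.cast_add, add_mul,
      Finset.sum_add_distrib, Finset.mul_sum]
    ring
  refine ⟨hmain, fun ⟨x, hx⟩ => ⟨x, ?_⟩⟩
  obtain ⟨m, c, h⟩ := hmain x hx
  rw [h x (mem_connectedComponentIn hx)]
  exact EReal.coe_ne_bot _
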